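/- Consider second-order predicate logic with Henkin interpretation (HPL), formulated in the many-sorted first-order language with identity that has individual variables and, for each $k\ge 1$, variables for $k$-ary predicates; its atomic formulas are the identities between variables of the same sort and the formulas $A x_1\dots x_k$. Let $\vdash$ be derivability in the classical many-sorted first-order predicate calculus with identity (free variables of axioms being read as universally quantified), and let ${}^h ax^{(2)}$ be the set of Henkin axioms: for every $k\ge1$, extensionality $\forall A\forall B(\forall\mathbf{x}(A\mathbf{x}\leftrightarrow B\mathbf{x})\to A=B)$ for $k$-ary predicates, and comprehension $\exists A\forall \mathbf{x}(A\mathbf{x}\leftrightarrow H)$ for all formulas $H$ in which the $k$-ary variable $A$ is not free. Let $choice_h^{(2)}$ be the set of all formulas $$\forall \mathbf{x}\,\exists D\, H(\mathbf{x},D)\ \to\ \exists S\,\forall\mathbf{x}\,\exists D\,\bigl(\forall\mathbf{y}\,(D\mathbf{y}\leftrightarrow S\mathbf{x}\mathbf{y})\wedge H(\mathbf{x},D)\bigr)$$ with $n,m\ge 1$, $\mathbf{x}$ an $n$-tuple and $\mathbf{y}$ an $m$-tuple of individual variables (all distinct), $D$ an $m$-ary and $S$ an $(n+m)$-ary predicate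 variable, and $H$ any formula (possibly with further free variables) in which $S$ is not free. For $n\ge 1$ let $TR^n$ be the sentence "for all $n$-ary predicates $A,B$ there is a $2n$-ary predicate that is an injective function from $A$ into $B$ or an injective function from $B$ into $A$", and let $LO^n$ be the sentence "for every $n$-ary predicate $A$ there is a $2n$-ary predicate that is a linear ordering of $A$". **Theorem.** For every $n\ge 1$, $TR^n$ and $LO^n$ are HPL-independent of $choice_h^{(2)}$; that is, $${}^h ax^{(2)}\cup choice_h^{(2)}\nvdash TR^n,\quad {}^h ax^{(2)}\cup choice_h^{(2)}\nvdash \neg TR^n,\quad {}^h ax^{(2)}\cup choice_h^{(2)}\nvdash LO^n,\quad {}^h ax^{(2)}\cup choice_h^{(2)}\nvdash \neg LO^n .$$ In particular, neither $TR^n$ nor $LO^n$ is derivable from the Henkin axioms together with the choice schema. -/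

import Mathlib

namespace HPL

/-- Formulas of the language of second-order predicate logic, presented as a many-sorted
first-order language with identity.  The sort `0` is the sort of individuals and, for `k ≥ 1`,
the sort `k` is the sort of `k`-ary predicates; for every sort `s` there are the variables
`v^s_0, v^s_1, v^s_2, …`.  Thus `v^0_i` is the individual variable `x_i` and `v^k_i` (with `k ≥ 1`)
is the `k`-ary predicate variable `A^k_i`. -/
inductive Formula : Type
  /-- falsity -/
  | falsum : Formula
  /-- `v^s_i = v^s_j` -/
  | eq (s i j : ℕ) : Formula
  /-- `A^k_i x_{a 0} … x_{a (k-1)}`, where `k ≥ 1` -/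
  | app (k : ℕ) (hk : 1 ≤ k) (i : ℕ) (a : Fin k → ℕ) : Formula
  /-- implication -/
  | imp (φ ψ : Formula) : Formula
  /-- `∀ v^s_i φ` -/
  | all (s i : ℕ) (φ : Formula) : Formula

namespace Formula

/-- Negation. -/
def neg (φ : Formula) : Formula := imp φ falsum

/-- Conjunction. -/
def conj (φ ψ : Formula) : Formula := neg (imp φ (neg ψ))

/-- Disjunction. -/
def disj (φ ψ : Formula) : Formula := imp (neg φ) ψ

/-- Equivalence. -/
def biimp (φ ψ : Formula) : Formula := conj (imp φ ψ) (imp ψ φ)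

/-- `∃ v^s_i φ`. -/
def ex (s i : ℕ) (φ : Formula) : Formula := neg (all s i (neg φ))

/-- `∀ x_{a 0} … ∀ x_{a (n-1)} φ`, for a tuple `a` of individual variables. -/
def allTuple {n : ℕ} (a : Fin n → ℕ) (φ : Formula) : Formula :=
  (List.ofFn a).foldr (fun i ψ => all 0 i ψ) φ

/-- `∃ x_{a 0} … ∃ x_{a (n-1)} φ`, for a tuple `a` of individual variables. -/
def exTuple {n : ℕ} (a : Fin n → ℕ) (φ : Formula) : Formula :=
  (List.ofFn a).foldr (fun i ψ => ex 0 i ψ) φ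

/-- `x_{a 0} = x_{b 0} ∧ … ∧ x_{a (n-1)} = x_{b (n-1)}` (a trivial conjunct is added at the end). -/
def eqTuple {n : ℕ} (a b : Fin n → ℕ) : Formula :=
  (List.ofFn fun t => eq 0 (a t) (b t)).foldr conj (neg falsum)

/-- The variable `v^s_i` occurs free in the formula. -/
def Free (s i : ℕ) : Formula → Prop
  | falsum => False
  | eq t a b => t = s ∧ (a = i ∨ b = i)
  | app k _ p a => (k = s ∧ p = i) ∨ (s = 0 ∧ ∃ t, a t = i)
  | imp φ ψ => Free s i φ ∨ Free s i ψ
  | all t a φ => ¬ (t = s ∧ a = i) ∧ Free s i φ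

/-- The index of the variable that replaces `v^t_a` when `v^s_i` is replaced by `v^s_j`. -/
def replace (s i j t a : ℕ) : ℕ := if t = s ∧ a = i then j else a

/-- The result of replacing all free occurrences of `v^s_i` by `v^s_j`. -/
def subst (s i j : ℕ) : Formula → Formula
  | falsum => falsum
  | eq t a b => eq t (replace s i j t a) (replace s i j t b)
  | app k hk p a => app k hk (replace s i j k p) (fun t => replace s i j 0 (a t))
  | imp φ ψ => imp (subst s i j φ) (subst s i j ψ)
  | all t a φ => if t = s ∧ a = i then all t a φ else all t a (subst s i j φ)

/-- `v^s_j` is free for `v^s_i`: no free occurrence of `v^s_i` lies in the scope of a quantifier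
that binds `v^s_j`. -/
def FreeFor (s i j : ℕ) : Formula → Prop
  | falsum => True
  | eq _ _ _ => True
  | app _ _ _ _ => True
  | imp φ ψ => FreeFor s i j φ ∧ FreeFor s i j ψ
  | all t a φ => ¬ Free s i (all t a φ) ∨ (¬ (t = s ∧ a = j) ∧ FreeFor s i j φ)

end Formula

open Formula

/-- Derivability `T ⊢ φ` in the standard Hilbert calculus of classical many-sorted first-order
logic with identity, for a set `T` of non-logical axioms.  Free variables of the axioms are
understood as universally quantified, so that generalization is unrestricted. -/
inductive Derivable (T : Set Formula) : Formula → Prop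
  | ax {φ : Formula} (h : φ ∈ T) : Derivable T φ
  | imp_intro (φ ψ : Formula) : Derivable T (imp φ (imp ψ φ))
  | imp_dist (φ ψ χ : Formula) :
      Derivable T (imp (imp φ (imp ψ χ)) (imp (imp φ ψ) (imp φ χ)))
  | dne (φ : Formula) : Derivable T (imp (neg (neg φ)) φ)
  | all_elim (s i j : ℕ) (φ : Formula) (h : FreeFor s i j φ) :
      Derivable T (imp (all s i φ) (subst s i j φ))
  | all_dist (s i : ℕ) (φ ψ : Formula) (h : ¬ Free s i φ) :
      Derivable T (imp (all s i (imp φ ψ)) (imp φ (all s i ψ)))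
  | eq_refl (s i : ℕ) : Derivable T (eq s i i)
  | eq_subst (s i j : ℕ) (φ : Formula) (h : FreeFor s i j φ) :
      Derivable T (imp (eq s i j) (imp φ (subst s i j φ)))
  | mp {φ ψ : Formula} (h₁ : Derivable T (imp φ ψ)) (h₂ : Derivable T φ) : Derivable T ψ
  | gen (s i : ℕ) {φ : Formula} (h : Derivable T φ) : Derivable T (all s i φ)

/-- Comprehension for the formula `H`, with `A = A^n_p`:
`∃ A ∀ x_1 … x_n (A x_1 … x_n ↔ H)`.  All other free variables of `H` are parameters. -/
def comprehension (n : ℕ) (hn : 1 ≤ n) (p : ℕ) (x : Fin n → ℕ) (H : Formula) : Formula :=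
  ex n p (allTuple x (biimp (app n hn p x) H))

/-- Extensionality for `n`-ary predicates, with `A = A^n_p`, `B = A^n_q`:
`∀ A ∀ B (∀ x_1 … x_n (A x_1 … x_n ↔ B x_1 … x_n) → A = B)`. -/
def extensionality (n : ℕ) (hn : 1 ≤ n) (p q : ℕ) (x : Fin n → ℕ) : Formula :=
  all n p (all n q (imp (allTuple x (biimp (app n hn p x) (app n hn q x))) (eq n p q)))

/-- The Henkin axioms: comprehension for all formulas `H` in which the comprehended predicate
variable is not free, and extensionality, for predicates of every arity `n ≥ 1`. -/
def henkinAxioms : Set Formula :=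
  {φ | ∃ (n : ℕ) (hn : 1 ≤ n) (p : ℕ) (x : Fin n → ℕ) (H : Formula),
    Function.Injective x ∧ ¬ Free n p H ∧ φ = comprehension n hn p x H} ∪
  {φ | ∃ (n : ℕ) (hn : 1 ≤ n) (p q : ℕ) (x : Fin n → ℕ),
    p ≠ q ∧ Function.Injective x ∧ φ = extensionality n hn p q x}

/-- The choice formula for `H`, with `D = A^m_d` and `S = A^(n+m)_r`:
`∀ x ∃ D H(x, D) → ∃ S ∀ x ∃ D (∀ y (D y ↔ S x y) ∧ H(x, D))`,
where `x` is an `n`-tuple and `y` an `m`-tuple of individual variables. -/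
def choiceFormula (n m : ℕ) (hm : 1 ≤ m) (x : Fin n → ℕ) (y : Fin m → ℕ) (d r : ℕ)
    (H : Formula) : Formula :=
  imp (allTuple x (ex m d H))
    (ex (n + m) r (allTuple x (ex m d
      (conj
        (allTuple y (biimp (app m hm d y)
          (app (n + m) (hm.trans (Nat.le_add_left m n)) r (Fin.append x y))))
        H))))

/-- The choice schema `choice_h^(2)`: all choice formulas with `n, m ≥ 1`, for all formulas `H`
(which may contain further free variables as parameters) in which `S` is not free; the variables
in the tuples `x`, `y` are pairwise distinct. -/
def choiceSchema : Set Formula :=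
  {φ | ∃ (n m : ℕ) (_ : 1 ≤ n) (hm : 1 ≤ m) (x : Fin n → ℕ) (y : Fin m → ℕ) (d r : ℕ)
      (H : Formula), Function.Injective (Fin.append x y) ∧ ¬ Free (n + m) r H ∧
      φ = choiceFormula n m hm x y d r H}

/-- The `c`-th block of `n` individual variables: `x_{c n}, …, x_{c n + n - 1}`.  Different blocks
are disjoint. -/
def block (n c : ℕ) : Fin n → ℕ := fun t => c * n + t

/-- The atomic formula `A x` for the `n`-ary predicate variable `A = A^n_p` and an `n`-tuple `x`. -/
def mem (n : ℕ) (hn : 1 ≤ n) (p : ℕ) (x : Fin n → ℕ) : Formula := app n hn p x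

/-- The atomic formula `R x y` for the `2n`-ary predicate variable `R = A^(n+n)_r` and `n`-tuples
`x`, `y`. -/
def rel (n : ℕ) (hn : 1 ≤ n) (r : ℕ) (x y : Fin n → ℕ) : Formula :=
  app (n + n) (hn.trans (Nat.le_add_left n n)) r (Fin.append x y)

/-- "`F` is (the graph of) an injective function from `A` into `B`", for `F = A^(n+n)_f`,
`A = A^n_p`, `B = A^n_q`: the conjunction of
`∀ x ∀ y (F x y → A x ∧ B y)`, `∀ x (A x → ∃ y F x y)`,
`∀ x ∀ y ∀ z (F x y ∧ F x z → y = z)` and `∀ x ∀ y ∀ z (F x z ∧ F y z → x = y)`. -/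
def injection (n : ℕ) (hn : 1 ≤ n) (f p q : ℕ) : Formula :=
  let x := block n 0
  let y := block n 1
  let z := block n 2
  conj (allTuple x (allTuple y (imp (rel n hn f x y) (conj (mem n hn p x) (mem n hn q y)))))
    (conj (allTuple x (imp (mem n hn p x) (exTuple y (rel n hn f x y))))
      (conj
        (allTuple x (allTuple y (allTuple z
          (imp (conj (rel n hn f x y) (rel n hn f x z)) (eqTuple y z)))))
        (allTuple x (allTuple y (allTuple z
          (imp (conj (rel n hn f x z) (rel n hn f y z)) (eqTuple x y)))))))

/-- The trichotomy law `TR^n`: for all `n`-ary predicates `A`, `B`, there is a `2n`-ary predicate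
that is an injection from `A` into `B` or an injection from `B` into `A`. -/
def TR (n : ℕ) (hn : 1 ≤ n) : Formula :=
  all n 0 (all n 1 (ex (n + n) 0 (disj (injection n hn 0 0 1) (injection n hn 0 1 0))))

/-- "`R` is a (reflexive) linear ordering of `A`", for `R = A^(n+n)_r`, `A = A^n_p`:
the conjunction of `∀ x ∀ y (R x y → A x ∧ A y)`, `∀ x ∀ y (A x ∧ A y → R x y ∨ R y x)`,
`∀ x ∀ y (R x y ∧ R y x → x = y)` and `∀ x ∀ y ∀ z (R x y ∧ R y z → R x z)`. -/
def linearOrdering (n : ℕ) (hn : 1 ≤ n) (r p : ℕ) : Formula :=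
  let x := block n 0
  let y := block n 1
  let z := block n 2
  conj (allTuple x (allTuple y (imp (rel n hn r x y) (conj (mem n hn p x) (mem n hn p y)))))
    (conj
      (allTuple x (allTuple y
        (imp (conj (mem n hn p x) (mem n hn p y)) (disj (rel n hn r x y) (rel n hn r y x)))))
      (conj
        (allTuple x (allTuple y (imp (conj (rel n hn r x y) (rel n hn r y x)) (eqTuple x y))))
        (allTuple x (allTuple y (allTuple z
          (imp (conj (rel n hn r x y) (rel n hn r y z)) (rel n hn r x z)))))))

/-- The linear ordering principle `LO^n`: for every `n`-ary predicate `A`, there is a `2n`-ary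
predicate that is a linear ordering of `A`. -/
def LO (n : ℕ) (hn : 1 ≤ n) : Formula :=
  all n 0 (ex (n + n) 0 (linearOrdering n hn 0 0))

/-- `φ` is HPL-independent of `G`: from the Henkin axioms together with `G`, neither `φ` nor its
negation is derivable. -/
def Independent (G : Set Formula) (φ : Formula) : Prop :=
  ¬ Derivable (henkinAxioms ∪ G) φ ∧ ¬ Derivable (henkinAxioms ∪ G) (neg φ)

end HPL

/-!
Independence is shown by two Henkin models and the soundness theorem `Model.sat_of_derivable`.

Both models are permutation models `permModel c`: for a colouring `c` of a set of atoms by finitely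
many colours, the individuals are the atoms and the `k`-ary predicates are the finitely supported
relations, i.e. those that are preserved by all colour-preserving permutations fixing each element
of some finite set of atoms.  Permutations act on the model by automorphisms (`sat_smulVal`), so a
relation defined by a formula is supported by the supports of the values of the free variables;
this gives comprehension.

The choice schema holds in every such model.  For choice depending on one atom
(`exists_uniform_choice`), pick one atom `a` of each colour outside the support of the parameters
and a witness `R a` for it.  For `x` of the same colour as `a`, outside the finitely many atoms
involved, let the witness for `x` be the image of `R a` under the transposition of `a` and `x`; the
resulting family is finitely supported, and choosing witnesses for finitely many further atoms keeps
it so.  Choice depending on a tuple follows by treating one entry after another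
(`exists_uniform_choice_tuple`), because a finitely supported family of predicates is a predicate
again.

With a single atom, `TR` and `LO` are trivially true.  With two colours of infinitely many atoms each,
both fail.  A linear ordering of all `n`-tuples would be preserved by the interchange of two atoms
outside its support (`not_sat_LO`).  An injection of the tuples of one colour into the tuples of the
other would take the same value at two constant tuples, since the interchange of their entries fixes
all tuples of the other colour (`not_isInjection_monochromatic`).
-/

namespace HPL

open Formula
open scoped Pointwise

/-! ### Semantics -/

/-- A structure for the many-sorted language: a domain `D s` for each sort `s` and, for each `k`, the
relation "the predicate `A` holds of the tuple `a`".  The value of `app 0` is never used. -/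
structure Model where
  D : ℕ → Type
  app : ∀ k, D k → (Fin k → D 0) → Prop

namespace Model

variable (M : Model)

/-- A valuation assigns to the variable `v^s_i` the element `v s i` of the domain of sort `s`. -/
abbrev Valuation := ∀ s, ℕ → M.D s

variable {M}

/-- The valuation `v`, changed at the variable `v^s_i` to the value `d`. -/
def upd (v : M.Valuation) (s i : ℕ) (d : M.D s) : M.Valuation :=
  Function.update v s (Function.update (v s) i d)

/-- The valuation `v`, changed at the individual variables `x` to the values `t`. This is meaningful
for injective tuples `x`. -/
noncomputable def updTuple (v : M.Valuation) {n : ℕ} (x : Fin n → ℕ) (t : Fin n → M.D 0) :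
    M.Valuation :=
  Function.update v 0 (Function.extend x t (v 0))

/-- Tarskian satisfaction. -/
def Sat : M.Valuation → Formula → Prop
  | _, falsum => False
  | v, eq s i j => v s i = v s j
  | v, Formula.app k _ p a => M.app k (v k p) (fun t => v 0 (a t))
  | v, imp φ ψ => Sat v φ → Sat v ψ
  | v, all s i φ => ∀ d, Sat (upd v s i d) φ

@[simp] theorem upd_same (v : M.Valuation) (s i : ℕ) (d : M.D s) : upd v s i d s i = d := by
  simp [upd]

theorem upd_of_ne (v : M.Valuation) {s i t j : ℕ} (d : M.D s) (h : ¬ (t = s ∧ j = i)) :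
    upd v s i d t j = v t j := by
  by_cases hs : t = s
  · subst hs
    have : j ≠ i := fun hj => h ⟨rfl, hj⟩
    simp [upd, this]
  · simp [upd, hs]

@[simp] theorem upd_of_sort_ne (v : M.Valuation) {s i t j : ℕ} (d : M.D s) (h : t ≠ s) :
    upd v s i d t j = v t j :=
  upd_of_ne v d fun h' => h h'.1

theorem upd_self (v : M.Valuation) (s i : ℕ) : upd v s i (v s i) = v := by
  simp [upd]

theorem updTuple_of_sort_ne (v : M.Valuation) {n : ℕ} (x : Fin n → ℕ) (t : Fin n → M.D 0)
    {s : ℕ} (hs : s ≠ 0) (j : ℕ) : updTuple v x t s j = v s j := by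
  simp [updTuple, hs]

theorem updTuple_apply (v : M.Valuation) {n : ℕ} {x : Fin n → ℕ} (hx : Function.Injective x)
    (t : Fin n → M.D 0) (i : Fin n) : updTuple v x t 0 (x i) = t i := by
  simp [updTuple, hx.extend_apply]

theorem updTuple_of_notMem (v : M.Valuation) {n : ℕ} {x : Fin n → ℕ} (t : Fin n → M.D 0) {j : ℕ}
    (hj : ∀ i, x i ≠ j) : updTuple v x t 0 j = v 0 j := by
  simp only [updTuple, Function.update_self]
  exact Function.extend_apply' _ _ _ (by rintro ⟨i, hi⟩; exact hj i hi)

theorem upd_congr {v w : M.Valuation} (s i : ℕ) (d : M.D s) {t j : ℕ} (h : v t j = w t j) :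
    upd v s i d t j = upd w s i d t j := by
  by_cases hs : t = s ∧ j = i
  · obtain ⟨rfl, rfl⟩ := hs
    simp
  · rw [upd_of_ne _ _ hs, upd_of_ne _ _ hs, h]

theorem updTuple_congr {v w : M.Valuation} {n : ℕ} (x : Fin n → ℕ) (t : Fin n → M.D 0) {s j : ℕ}
    (h : v s j = w s j) : updTuple v x t s j = updTuple w x t s j := by
  by_cases hs : s = 0
  · subst hs
    simp only [updTuple, Function.update_self, Function.extend]
    rw [h]
  · rw [updTuple_of_sort_ne _ _ _ hs, updTuple_of_sort_ne _ _ _ hs, h]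

theorem sat_congr {φ : Formula} {v w : M.Valuation} (h : ∀ s i, Free s i φ → v s i = w s i) :
    Sat v φ ↔ Sat w φ := by
  induction φ generalizing v w with
  | falsum => rfl
  | eq s i j =>
    simp only [Sat]
    rw [h s i ⟨rfl, .inl rfl⟩, h s j ⟨rfl, .inr rfl⟩]
  | app k hk p a =>
    simp only [Sat]
    rw [h k p (.inl ⟨rfl, rfl⟩)]
    have : (fun t => v 0 (a t)) = fun t => w 0 (a t) :=
      funext fun t => h 0 (a t) (.inr ⟨rfl, t, rfl⟩)
    rw [this]
  | imp φ ψ ihφ ihψ =>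
    simp only [Sat]
    rw [ihφ fun s i hf => h s i (.inl hf), ihψ fun s i hf => h s i (.inr hf)]
  | all t a φ ih =>
    simp only [Sat]
    refine forall_congr' fun d => ih fun s i hf => ?_
    by_cases hs : t = s ∧ a = i
    · obtain ⟨rfl, rfl⟩ := hs
      simp
    · exact upd_congr _ _ _ (h s i ⟨hs, hf⟩)

theorem sat_upd_of_not_free {φ : Formula} {s i : ℕ} (h : ¬ Free s i φ) (v : M.Valuation)
    (d : M.D s) : Sat (upd v s i d) φ ↔ Sat v φ :=
  sat_congr fun t j hf => upd_of_ne _ _ (by rintro ⟨rfl, rfl⟩; exact h hf)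

theorem upd_comm (v : M.Valuation) {s i t j : ℕ} (d : M.D s) (e : M.D t) (h : ¬ (t = s ∧ j = i)) :
    upd (upd v s i d) t j e = upd (upd v t j e) s i d := by
  funext u l
  by_cases h1 : u = t ∧ l = j
  · obtain ⟨rfl, rfl⟩ := h1
    rw [upd_same, upd_of_ne _ _ h, upd_same]
  · rw [upd_of_ne _ _ h1]
    by_cases h2 : u = s ∧ l = i
    · obtain ⟨rfl, rfl⟩ := h2
      rw [upd_same, upd_same]
    · rw [upd_of_ne _ _ h2, upd_of_ne _ _ h2, upd_of_ne _ _ h1]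

theorem subst_of_not_free {φ : Formula} {s i : ℕ} (j : ℕ) (h : ¬ Free s i φ) :
    subst s i j φ = φ := by
  induction φ with
  | falsum => rfl
  | eq t a b =>
    simp only [Free, not_and, not_or] at h
    simp only [subst, replace]
    rw [if_neg fun h' => (h h'.1).1 h'.2, if_neg fun h' => (h h'.1).2 h'.2]
  | app k hk p a =>
    simp only [Free, not_or, not_and, not_exists] at h
    simp only [subst, replace]
    rw [if_neg fun h' => h.1 h'.1 h'.2]
    congr 1
    funext t
    rw [if_neg fun h' => h.2 h'.1.symm t h'.2]
  | imp φ ψ ihφ ihψ =>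
    simp only [Free, not_or] at h
    rw [subst, ihφ h.1, ihψ h.2]
  | all t a φ ih =>
    simp only [Free, not_and] at h
    by_cases ht : t = s ∧ a = i
    · rw [subst, if_pos ht]
    · rw [subst, if_neg ht, ih (h fun h₁ h₂ => ht ⟨h₁, h₂⟩)]

theorem upd_replace (v : M.Valuation) (s i j t a : ℕ) :
    v t (replace s i j t a) = upd v s i (v s j) t a := by
  unfold replace
  split_ifs with h
  · obtain ⟨rfl, rfl⟩ := h
    simp
  · rw [upd_of_ne _ _ h]

theorem sat_subst {φ : Formula} {s i j : ℕ} (h : FreeFor s i j φ) (v : M.Valuation) :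
    Sat v (subst s i j φ) ↔ Sat (upd v s i (v s j)) φ := by
  induction φ generalizing v with
  | falsum => rfl
  | eq t a b => simp only [subst, Sat, upd_replace]
  | app k hk p a => simp only [subst, Sat, upd_replace]
  | imp φ ψ ihφ ihψ => simp only [subst, Sat, ihφ h.1, ihψ h.2]
  | all t a φ ih =>
    by_cases hf : Free s i (all t a φ)
    · obtain ⟨hj, h'⟩ := h.resolve_left (not_not_intro hf)
      rw [subst, if_neg hf.1]
      simp only [Sat]
      refine forall_congr' fun d => ?_
      rw [ih h', upd_comm _ _ _ hf.1, upd_of_ne _ _ fun h'' => hj ⟨h''.1.symm, h''.2.symm⟩]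
    · rw [subst_of_not_free j hf, sat_upd_of_not_free hf]

theorem sat_of_derivable {T : Set Formula} (hT : ∀ φ ∈ T, ∀ v : M.Valuation, Sat v φ)
    {φ : Formula} (h : Derivable T φ) (v : M.Valuation) : Sat v φ := by
  induction h generalizing v with
  | ax h => exact hT _ h v
  | imp_intro φ ψ => exact fun h _ => h
  | imp_dist φ ψ χ => exact fun h₁ h₂ h₃ => h₁ h₃ (h₂ h₃)
  | dne φ => exact fun h => not_not.mp h
  | all_elim s i j φ h => exact fun h' => (sat_subst h v).mpr (h' _)
  | all_dist s i φ ψ h => exact fun h₁ h₂ d => h₁ d ((sat_upd_of_not_free h v d).mpr h₂)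
  | eq_refl s i => exact rfl
  | eq_subst s i j φ h =>
    intro (he : v s i = v s j) hφ
    rw [sat_subst h, ← he, upd_self]
    exact hφ
  | mp _ _ ih₁ ih₂ => exact ih₁ v (ih₂ v)
  | gen s i _ ih => exact fun d => ih _

/-! ### Satisfaction of the derived connectives -/

@[simp] theorem sat_falsum (v : M.Valuation) : Sat v falsum ↔ False := Iff.rfl

theorem sat_app (v : M.Valuation) {k : ℕ} (hk : 1 ≤ k) (p : ℕ) (a : Fin k → ℕ) :
    Sat v (Formula.app k hk p a) ↔ M.app k (v k p) fun t => v 0 (a t) := Iff.rfl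

@[simp] theorem sat_imp (v : M.Valuation) (φ ψ : Formula) :
    Sat v (imp φ ψ) ↔ (Sat v φ → Sat v ψ) := Iff.rfl

@[simp] theorem sat_all (v : M.Valuation) (s i : ℕ) (φ : Formula) :
    Sat v (all s i φ) ↔ ∀ d, Sat (upd v s i d) φ := Iff.rfl

@[simp] theorem sat_neg (v : M.Valuation) (φ : Formula) : Sat v (neg φ) ↔ ¬ Sat v φ := Iff.rfl

@[simp] theorem sat_conj (v : M.Valuation) (φ ψ : Formula) :
    Sat v (conj φ ψ) ↔ Sat v φ ∧ Sat v ψ := by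
  simp [conj]

@[simp] theorem sat_disj (v : M.Valuation) (φ ψ : Formula) :
    Sat v (disj φ ψ) ↔ Sat v φ ∨ Sat v ψ := by
  simp [disj, or_iff_not_imp_left]

@[simp] theorem sat_biimp (v : M.Valuation) (φ ψ : Formula) :
    Sat v (biimp φ ψ) ↔ (Sat v φ ↔ Sat v ψ) := by
  simp [biimp, iff_def]

@[simp] theorem sat_ex (v : M.Valuation) (s i : ℕ) (φ : Formula) :
    Sat v (ex s i φ) ↔ ∃ d, Sat (upd v s i d) φ := by
  simp [ex]

theorem updTuple_cons (v : M.Valuation) {n : ℕ} {x : Fin (n + 1) → ℕ} (hx : Function.Injective x)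
    (d : M.D 0) (t : Fin n → M.D 0) :
    updTuple (upd v 0 (x 0) d) (fun i => x i.succ) t
      = updTuple v x (Fin.cons d t : Fin (n + 1) → M.D 0) := by
  have hx' : Function.Injective fun i : Fin n => x i.succ :=
    hx.comp (Fin.succ_injective n)
  funext s j
  by_cases hs : s = 0
  · subst hs
    by_cases hj : ∃ i, x i = j
    · obtain ⟨i, rfl⟩ := hj
      rw [updTuple_apply v hx]
      induction i using Fin.cases with
      | zero =>
        rw [updTuple_of_notMem _ _ fun i h => Fin.succ_ne_zero i (hx h), upd_same, Fin.cons_zero]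
      | succ i => rw [Fin.cons_succ]; exact updTuple_apply _ hx' t i
    · push Not at hj
      rw [updTuple_of_notMem _ _ hj, updTuple_of_notMem _ _ fun i => hj i.succ,
        upd_of_ne _ _ fun h => hj 0 h.2.symm]
  · rw [updTuple_of_sort_ne _ _ _ hs, updTuple_of_sort_ne _ _ _ hs, upd_of_sort_ne _ _ hs]

theorem updTuple_zero (v : M.Valuation) (x : Fin 0 → ℕ) (t : Fin 0 → M.D 0) :
    updTuple v x t = v := by
  funext s j
  by_cases hs : s = 0
  · subst hs
    exact updTuple_of_notMem _ _ fun i => i.elim0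
  · exact updTuple_of_sort_ne _ _ _ hs _

theorem sat_allTuple (v : M.Valuation) {n : ℕ} {x : Fin n → ℕ} (hx : Function.Injective x)
    (φ : Formula) : Sat v (allTuple x φ) ↔ ∀ t, Sat (updTuple v x t) φ := by
  induction n generalizing v with
  | zero => simp [allTuple, updTuple_zero]
  | succ n ih =>
    have : allTuple x φ = all 0 (x 0) (allTuple (fun i => x i.succ) φ) := by
      simp [allTuple, List.ofFn_succ]
    rw [this, sat_all, Fin.forall_fin_succ_pi]
    refine forall_congr' fun d => ?_
    rw [ih _ (x := fun i => x i.succ) (hx.comp (Fin.succ_injective n))]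
    exact forall_congr' fun t => by rw [updTuple_cons v hx]

theorem sat_exTuple (v : M.Valuation) {n : ℕ} {x : Fin n → ℕ} (hx : Function.Injective x)
    (φ : Formula) : Sat v (exTuple x φ) ↔ ∃ t, Sat (updTuple v x t) φ := by
  induction n generalizing v with
  | zero => simp [exTuple, updTuple_zero]
  | succ n ih =>
    have : exTuple x φ = ex 0 (x 0) (exTuple (fun i => x i.succ) φ) := by
      simp [exTuple, List.ofFn_succ]
    rw [this, sat_ex, Fin.exists_fin_succ_pi]
    refine exists_congr fun d => ?_
    rw [ih _ (x := fun i => x i.succ) (hx.comp (Fin.succ_injective n))]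
    exact exists_congr fun t => by rw [updTuple_cons v hx]

theorem sat_eqTuple (v : M.Valuation) {n : ℕ} (a b : Fin n → ℕ) :
    Sat v (eqTuple a b) ↔ (fun i => v 0 (a i)) = fun i => v 0 (b i) := by
  rw [funext_iff]
  induction n with
  | zero => simp [eqTuple]
  | succ n ih =>
    have : eqTuple a b
        = conj (eq 0 (a 0) (b 0)) (eqTuple (fun i => a i.succ) (fun i => b i.succ)) := by
      simp [eqTuple, List.ofFn_succ]
    rw [this, sat_conj, ih, Fin.forall_fin_succ]
    rfl

/-! ### The meaning of trichotomy and linear orderability -/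

/-- The binary relation between `n`-tuples that is encoded by a `2n`-ary predicate. -/
def Rel {n : ℕ} (R : M.D (n + n)) (x y : Fin n → M.D 0) : Prop :=
  M.app (n + n) R (Fin.append x y)

/-- The `2n`-ary predicate `F` is an injective function from `A` into `B`. -/
def IsInjection {n : ℕ} (F : M.D (n + n)) (A B : M.D n) : Prop :=
  (∀ x y, Rel F x y → M.app n A x ∧ M.app n B y) ∧
  (∀ x, M.app n A x → ∃ y, Rel F x y) ∧
  (∀ x y z, Rel F x y ∧ Rel F x z → y = z) ∧
  (∀ x y z, Rel F x z ∧ Rel F y z → x = y)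

/-- The `2n`-ary predicate `R` is a linear ordering of `A`. -/
def IsLinearOrdering {n : ℕ} (R : M.D (n + n)) (A : M.D n) : Prop :=
  (∀ x y, Rel R x y → M.app n A x ∧ M.app n A y) ∧
  (∀ x y, M.app n A x ∧ M.app n A y → Rel R x y ∨ Rel R y x) ∧
  (∀ x y, Rel R x y ∧ Rel R y x → x = y) ∧
  (∀ x y z, Rel R x y ∧ Rel R y z → Rel R x z)

theorem block_injective (n c : ℕ) : Function.Injective (block n c) := fun i j h => by
  simpa [block, Fin.ext_iff] using h

theorem block_ne {n c d : ℕ} (h : c ≠ d) (i j : Fin n) : block n c i ≠ block n d j := by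
  intro he
  have hn : 0 < n := i.pos
  have := congrArg (· / n) he
  simp only [block, Nat.mul_comm _ n, Nat.mul_add_div hn, Nat.div_eq_of_lt i.2,
    Nat.div_eq_of_lt j.2, Nat.add_zero] at this
  exact h this

theorem comp_append (v : M.Valuation) {n m : ℕ} (x : Fin n → ℕ) (y : Fin m → ℕ) :
    (fun i => v 0 (Fin.append x y i))
      = Fin.append (fun i => v 0 (x i)) (fun i => v 0 (y i)) := by
  funext i
  induction i using Fin.addCases <;> simp

theorem sat_mem (v : M.Valuation) {n : ℕ} (hn : 1 ≤ n) (p : ℕ) (x : Fin n → ℕ) :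
    Sat v (mem n hn p x) ↔ M.app n (v n p) fun i => v 0 (x i) := Iff.rfl

theorem sat_rel (v : M.Valuation) {n : ℕ} (hn : 1 ≤ n) (r : ℕ) (x y : Fin n → ℕ) :
    Sat v (rel n hn r x y) ↔ Rel (v (n + n) r) (fun i => v 0 (x i)) (fun i => v 0 (y i)) := by
  rw [Rel, ← comp_append]
  rfl

theorem updTuple_block_same (v : M.Valuation) {n : ℕ} (c : ℕ) (t : Fin n → M.D 0) :
    (fun i => updTuple v (block n c) t 0 (block n c i)) = t :=
  funext fun i => updTuple_apply v (block_injective n c) t i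

theorem updTuple_block_of_ne (v : M.Valuation) {n c d : ℕ} (h : c ≠ d) (t : Fin n → M.D 0) :
    (fun i => updTuple v (block n c) t 0 (block n d i)) = fun i => v 0 (block n d i) :=
  funext fun i => updTuple_of_notMem v t fun j => block_ne h j i

theorem sat_injection (v : M.Valuation) {n : ℕ} (hn : 1 ≤ n) (f p q : ℕ) :
    Sat v (injection n hn f p q) ↔ IsInjection (v (n + n) f) (v n p) (v n q) := by
  have h₁ : n ≠ 0 := by omega
  simp [injection, IsInjection, sat_allTuple _ (block_injective _ _),
    sat_exTuple _ (block_injective _ _), sat_mem, sat_rel, sat_eqTuple, updTuple_block_same,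
    updTuple_block_of_ne, updTuple_of_sort_ne, h₁]

theorem sat_linearOrdering (v : M.Valuation) {n : ℕ} (hn : 1 ≤ n) (r p : ℕ) :
    Sat v (linearOrdering n hn r p) ↔ IsLinearOrdering (v (n + n) r) (v n p) := by
  have h₁ : n ≠ 0 := by omega
  simp [linearOrdering, IsLinearOrdering, sat_allTuple _ (block_injective _ _),
    sat_mem, sat_rel, sat_eqTuple, updTuple_block_same,
    updTuple_block_of_ne, updTuple_of_sort_ne, h₁]

theorem sat_TR (v : M.Valuation) {n : ℕ} (hn : 1 ≤ n) :
    Sat v (TR n hn) ↔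
      ∀ A B : M.D n, ∃ F : M.D (n + n), IsInjection F A B ∨ IsInjection F B A := by
  have h : n ≠ n + n := by omega
  have h₀ : ∀ (A B : M.D n), upd (upd v n 0 A) n 1 B n 0 = A := fun A B => by
    rw [upd_of_ne _ _ (by simp), upd_same]
  simp only [TR, sat_all, sat_ex, sat_disj, sat_injection, upd_same, upd_of_sort_ne _ _ h, h₀]

theorem sat_LO (v : M.Valuation) {n : ℕ} (hn : 1 ≤ n) :
    Sat v (LO n hn) ↔ ∀ A : M.D n, ∃ R : M.D (n + n), IsLinearOrdering R A := by
  have h : n ≠ n + n := by omega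
  simp only [LO, sat_all, sat_ex, sat_linearOrdering, upd_same, upd_of_sort_ne _ _ h]

end Model

/-! ### Colour-preserving permutations and finite supports -/

section Permutations

variable {I C : Type} (c : I → C)

/-- The group of the permutations of the atoms `I` that preserve the colouring `c`. -/
def colorGroup : Subgroup (Equiv.Perm I) where
  carrier := {σ | ∀ a, c (σ a) = c a}
  one_mem' := fun _ => rfl
  mul_mem' := fun {σ τ} hσ hτ a => (hσ (τ a)).trans (hτ a)
  inv_mem' := fun {σ} hσ a => by simpa using (hσ (σ⁻¹ a)).symm

variable {c}

/-- The transposition of two atoms of the same colour. -/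
def colorSwap [DecidableEq I] {a b : I} (h : c a = c b) : colorGroup c :=
  ⟨Equiv.swap a b, fun x => by
    rw [Equiv.swap_apply_def]
    split_ifs with h₁ h₂
    · rw [h₁, h]
    · rw [h₂, h]
    · rfl⟩

section Swap

variable [DecidableEq I] {a b : I} (h : c a = c b)

theorem colorSwap_smul_left : colorSwap h • a = b := Equiv.swap_apply_left a b

theorem colorSwap_smul_right : colorSwap h • b = a := Equiv.swap_apply_right a b

theorem colorSwap_smul_of_ne {x : I} (ha : x ≠ a) (hb : x ≠ b) : colorSwap h • x = x :=
  Equiv.swap_apply_of_ne_of_ne ha hb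

end Swap

variable (c) in
/-- `x` is fixed by all colour-preserving permutations that fix each atom of some finite set. -/
def FinitelySupported {X : Type} [MulAction (colorGroup c) X] (x : X) : Prop :=
  ∃ F : Finset I, MulAction.Supports (colorGroup c) (F : Set I) x

variable {X Y : Type} [MulAction (colorGroup c) X] [MulAction (colorGroup c) Y]

theorem FinitelySupported.smul {x : X} (h : FinitelySupported c x) (g : colorGroup c) :
    FinitelySupported c (g • x) := by
  classical
  obtain ⟨F, hF⟩ := h
  refine ⟨F.image (g • ·), fun σ hσ => ?_⟩
  have : (g⁻¹ * σ * g) • x = x := hF _ fun a ha => by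
    rw [mul_smul, mul_smul, hσ (Finset.mem_coe.mpr (Finset.mem_image_of_mem _ ha)), inv_smul_smul]
  rwa [mul_smul, mul_smul, inv_smul_eq_iff] at this

/-- For a set, one inclusion suffices, since the permutations form a group. -/
theorem supports_set_of_forall {P : Set I} {S : Set X}
    (h : ∀ g : colorGroup c, (∀ a ∈ P, g • a = a) → ∀ x ∈ S, g • x ∈ S) :
    MulAction.Supports (colorGroup c) P S := by
  intro g hg
  refine Set.Subset.antisymm ?_ fun x hx => ?_
  · rintro _ ⟨x, hx, rfl⟩
    exact h g (fun a ha => hg ha) x hx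
  · refine Set.mem_smul_set_iff_inv_smul_mem.mpr (h g⁻¹ (fun a ha => ?_) x hx)
    rw [inv_smul_eq_iff, hg ha]

theorem FinitelySupported.preimage {S : Set Y} (h : FinitelySupported c S) {f : X → Y}
    (hf : ∀ (g : colorGroup c) x, f (g • x) = g • f x) : FinitelySupported c (f ⁻¹' S) := by
  obtain ⟨F, hF⟩ := h
  refine ⟨F, supports_set_of_forall fun g hg x hx => ?_⟩
  rw [Set.mem_preimage, hf, ← hF g fun a ha => hg a ha]
  exact Set.smul_mem_smul_set hx

/-! ### Choice of finitely supported sets -/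

/-- Choice of finitely supported sets `R` depending on one atom `x`, for an invariant condition
`H x R`.  Pick one atom of every colour outside the support `P`, together with a witness for it, and
transport these witnesses by transpositions; only the finitely many atoms in the union `Q` of `P`
with the supports of the witnesses need individual choices. -/
theorem exists_uniform_choice [Finite C] {P : Finset I} {H : I → Set Y → Prop}
    (hH : ∀ g : colorGroup c, (∀ a ∈ P, g • a = a) → ∀ x R, H x R → H (g • x) (g • R))
    (hex : ∀ x, ∃ R, FinitelySupported c R ∧ H x R) :
    ∃ S : Set (I × Y), FinitelySupported c S ∧ ∀ x, H x {y | (x, y) ∈ S} := by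
  classical
  have := Fintype.ofFinite C
  choose R hR hHR using hex
  choose F hF using hR
  have hrep : ∀ k : C, ∃ z : Option I, (∀ a ∈ z, c a = k ∧ a ∉ P) ∧
      ∀ x, x ∉ P → c x = k → z.isSome := by
    intro k
    by_cases h : ∃ x, x ∉ P ∧ c x = k
    · obtain ⟨x, hx, hk⟩ := h
      exact ⟨some x, by simp [hx, hk], by simp⟩
    · exact ⟨none, by simp, fun x hx hk => (h ⟨x, hx, hk⟩).elim⟩
  choose z hz hz' using hrep
  let Q : Finset I := P ∪ Finset.univ.biUnion fun k => (z k).elim ∅ fun a => insert a (F a)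
  have hPQ : P ⊆ Q := Finset.subset_union_left
  have hQ : ∀ k, ∀ a ∈ z k, insert a (F a) ⊆ Q := by
    intro k a ha
    refine Finset.Subset.trans ?_ Finset.subset_union_right
    refine Finset.Subset.trans ?_ (Finset.subset_biUnion_of_mem _ (Finset.mem_univ k))
    rw [Option.mem_def.mp ha]
    exact Finset.Subset.refl _
  -- Outside `Q`, the value at `x` is the witness of the representative of its colour, transported.
  have hval : ∀ x, ∃ T : Set Y, (x ∈ Q → T = R x) ∧
      (x ∉ Q → ∃ (a : I) (h : c a = c x), a ∈ z (c x) ∧ T = colorSwap h • R a) := by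
    intro x
    by_cases hx : x ∈ Q
    · exact ⟨R x, fun _ => rfl, fun h => (h hx).elim⟩
    · obtain ⟨a, ha⟩ := Option.isSome_iff_exists.mp (hz' (c x) x (fun h => hx (hPQ h)) rfl)
      exact ⟨_, fun h => (hx h).elim, fun _ => ⟨a, (hz _ a ha).1, ha, rfl⟩⟩
  choose T hT hT' using hval
  refine ⟨{p | p.2 ∈ T p.1}, ⟨Q ∪ Q.biUnion F, supports_set_of_forall ?_⟩, fun x => ?_⟩
  · rintro g hg ⟨x, y⟩ hxy
    have hgQ : ∀ a ∈ Q, g • a = a := fun a ha => hg a (by simp [ha])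
    change g • y ∈ T (g • x)
    change y ∈ T x at hxy
    by_cases hx : x ∈ Q
    · rw [hgQ x hx, hT x hx, ← hF x g fun a ha => hg a (by
        simpa using Or.inr ⟨x, hx, ha⟩)]
      rw [hT x hx] at hxy
      exact Set.smul_mem_smul_set hxy
    · have hgx : g • x ∉ Q := fun h => hx (by
        have := hgQ _ h
        rwa [smul_left_cancel g this] at h)
      obtain ⟨a, h₁, ha, he⟩ := hT' x hx
      obtain ⟨a', h₂, ha', he'⟩ := hT' (g • x) hgx
      have hcg : c (g • x) = c x := g.2 x
      have haa : a' = a := by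
        rw [hcg] at ha'
        exact Option.some.inj ((Option.mem_def.mp ha').symm.trans (Option.mem_def.mp ha))
      subst haa
      have haQ : ∀ b ∈ insert a' (F a'), b ∈ Q := fun b hb => hQ _ a' ha hb
      -- This permutation fixes the representative and the support of its witness.
      have hfix : ((colorSwap h₂)⁻¹ * g * colorSwap h₁) • R a' = R a' := hF a' _ fun b hb => by
        have hbQ := haQ b (Finset.mem_insert_of_mem hb)
        rw [mul_smul, mul_smul, inv_smul_eq_iff]
        by_cases hba : b = a'
        · rw [hba, colorSwap_smul_left, colorSwap_smul_left]
        · rw [colorSwap_smul_of_ne h₁ hba (fun h => hx (h ▸ hbQ)), hgQ b hbQ,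
            colorSwap_smul_of_ne h₂ hba (fun h => hgx (h ▸ hbQ))]
      rw [mul_smul, mul_smul, inv_smul_eq_iff] at hfix
      rw [he', ← hfix, ← he]
      exact Set.smul_mem_smul_set hxy
  · change H x (T x)
    by_cases hx : x ∈ Q
    · rw [hT x hx]
      exact hHR x
    · obtain ⟨a, h, ha, he⟩ := hT' x hx
      have := hH (colorSwap h) (fun b hb => colorSwap_smul_of_ne h
        (fun h' => (hz _ a ha).2 (h' ▸ hb)) (fun h' => hx (hPQ (h' ▸ hb)))) a (R a) (hHR a)
      rwa [colorSwap_smul_left, ← he] at this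

theorem smul_setOf_prodMk_mem (g : colorGroup c) (x : X) (S : Set (X × Y)) :
    g • {y | (x, y) ∈ S} = {y | (g • x, y) ∈ g • S} := by
  ext y
  simp only [Set.mem_smul_set_iff_inv_smul_mem, Set.mem_ofPred_eq, Prod.smul_mk, inv_smul_smul]

theorem smul_fin_cons {n : ℕ} (g : colorGroup c) (x : I) (a : Fin n → I) :
    (g • (Fin.cons x a : Fin (n + 1) → I)) = (Fin.cons (g • x) (g • a) : Fin (n + 1) → I) := by
  funext i
  induction i using Fin.cases <;> rfl

/-- Choice of finitely supported sets depending on a tuple of atoms: the case of one atom is applied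
to one entry of the tuple after another. -/
theorem exists_uniform_choice_tuple [Finite C] {n : ℕ} {P : Finset I}
    {H : (Fin n → I) → Set Y → Prop}
    (hH : ∀ g : colorGroup c, (∀ a ∈ P, g • a = a) → ∀ x R, H x R → H (g • x) (g • R))
    (hex : ∀ x, ∃ R, FinitelySupported c R ∧ H x R) :
    ∃ S : Set ((Fin n → I) × Y), FinitelySupported c S ∧ ∀ x, H x {y | (x, y) ∈ S} := by
  classical
  induction n generalizing P with
  | zero =>
    obtain ⟨R, hR, hHR⟩ := hex Fin.elim0
    refine ⟨Prod.snd ⁻¹' R, hR.preimage fun _ _ => rfl, fun x => ?_⟩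
    rw [Subsingleton.elim x Fin.elim0]
    exact hHR
  | succ n ih =>
    have hex' : ∀ x : I, ∃ S : Set ((Fin n → I) × Y), FinitelySupported c S ∧
        ∀ a, H (Fin.cons x a) {y | (a, y) ∈ S} := by
      intro x
      refine ih (P := insert x P) (H := fun a R => H (Fin.cons x a) R) (fun g hg a R h => ?_)
        fun a => hex _
      have := hH g (fun b hb => hg b (Finset.mem_insert_of_mem hb)) _ R h
      rwa [smul_fin_cons, hg x (Finset.mem_insert_self x P)] at this
    obtain ⟨S, hS, hHS⟩ := exists_uniform_choice (P := P)
      (H := fun x (S : Set ((Fin n → I) × Y)) => ∀ a, H (Fin.cons x a) {y | (a, y) ∈ S})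
      (fun g hg x S h a => by
        have := hH g hg _ _ (h (g⁻¹ • a))
        rwa [smul_fin_cons, smul_setOf_prodMk_mem, smul_inv_smul] at this) hex'
    refine ⟨(fun p => (p.1 0, (Fin.tail p.1, p.2))) ⁻¹' S, hS.preimage fun _ _ => rfl,
      fun x => ?_⟩
    have := hHS (x 0) (Fin.tail x)
    rwa [Fin.cons_self_tail] at this

/-! ### The permutation model -/

variable (c) in
/-- The domains of the permutation model: the atoms, and the finitely supported sets of tuples. -/
@[reducible] def PermDomain : ℕ → Type
  | 0 => I
  | k + 1 => {R : Set (Fin (k + 1) → I) // FinitelySupported c R}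

variable (c) in
/-- The permutation model: individuals are the atoms, and predicates are all finitely supported
relations. -/
@[reducible] def permModel : Model where
  D := PermDomain c
  app
    | 0, _, _ => False
    | _ + 1, R, a => a ∈ R.1

instance : ∀ s, MulAction (colorGroup c) (PermDomain c s)
  | 0 => inferInstanceAs (MulAction (colorGroup c) I)
  | _ + 1 =>
    { smul := fun g R => ⟨g • R.1, R.2.smul g⟩
      one_smul := fun R => Subtype.ext (one_smul _ R.1)
      mul_smul := fun g h R => Subtype.ext (mul_smul g h R.1) }

theorem PermDomain.finitelySupported : ∀ {s : ℕ} (A : PermDomain c s), FinitelySupported c A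
  | 0, x => ⟨({x} : Finset I), fun _ hg =>
      hg (Finset.mem_coe.mpr (Finset.mem_singleton_self (α := I) x))⟩
  | _ + 1, R => R.2.imp fun _ hF g hg => Subtype.ext (hF g hg)

/-- The predicate with a given finitely supported extension. -/
def mkPred : ∀ {k : ℕ}, 1 ≤ k → (R : Set (Fin k → I)) → FinitelySupported c R → PermDomain c k
  | 0, hk, _, _ => absurd hk (by decide)
  | _ + 1, _, R, hR => ⟨R, hR⟩

theorem app_mkPred {k : ℕ} (hk : 1 ≤ k) (R : Set (Fin k → I)) (hR : FinitelySupported c R)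
    (a : Fin k → I) : (permModel c).app k (mkPred hk R hR) a ↔ a ∈ R := by
  cases k with
  | zero => omega
  | succ k => rfl

theorem smul_mkPred {k : ℕ} (hk : 1 ≤ k) (R : Set (Fin k → I)) (hR : FinitelySupported c R)
    (g : colorGroup c) : g • mkPred hk R hR = mkPred hk (g • R) (hR.smul g) := by
  cases k with
  | zero => omega
  | succ k => rfl

theorem exists_eq_mkPred {k : ℕ} (hk : 1 ≤ k) (A : PermDomain c k) :
    ∃ R hR, A = mkPred hk R hR := by
  cases k with
  | zero => omega
  | succ k => exact ⟨A.1, A.2, rfl⟩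

theorem app_smul {k : ℕ} (hk : 1 ≤ k) (g : colorGroup c) (A : PermDomain c k) (a : Fin k → I) :
    (permModel c).app k (g • A) (g • a) ↔ (permModel c).app k A a := by
  obtain ⟨R, hR, rfl⟩ := exists_eq_mkPred hk A
  rw [smul_mkPred, app_mkPred, app_mkPred, Set.smul_mem_smul_set_iff]

theorem permModel_ext {k : ℕ} (hk : 1 ≤ k) {A B : PermDomain c k}
    (h : ∀ a, (permModel c).app k A a ↔ (permModel c).app k B a) : A = B := by
  obtain ⟨R, hR, rfl⟩ := exists_eq_mkPred hk A
  obtain ⟨S, hS, rfl⟩ := exists_eq_mkPred hk B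
  obtain rfl : R = S := Set.ext fun a => by rw [← app_mkPred hk R hR, h, app_mkPred]
  rfl

/-- The action of a permutation on a valuation in the permutation model. -/
def smulVal (g : colorGroup c) (v : (permModel c).Valuation) : (permModel c).Valuation :=
  fun s i => (g • (v s i : PermDomain c s) : PermDomain c s)

theorem smulVal_upd (g : colorGroup c) (v : (permModel c).Valuation) (s i : ℕ)
    (d : PermDomain c s) :
    smulVal g (Model.upd v s i d) = Model.upd (smulVal g v) s i (g • d : PermDomain c s) := by
  funext t j
  by_cases h : t = s ∧ j = i
  · obtain ⟨rfl, rfl⟩ := h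
    simp only [smulVal, Model.upd_same]
  · simp only [smulVal, Model.upd_of_ne _ _ h]

theorem smulVal_updTuple (g : colorGroup c) (v : (permModel c).Valuation) {n : ℕ} {x : Fin n → ℕ}
    (hx : Function.Injective x) (a : Fin n → I) :
    smulVal g (Model.updTuple v x a) = Model.updTuple (smulVal g v) x (g • a) := by
  funext t j
  by_cases ht : t = 0
  · subst ht
    by_cases hj : ∃ i, x i = j
    · obtain ⟨i, rfl⟩ := hj
      rw [Model.updTuple_apply _ hx, smulVal, Model.updTuple_apply _ hx]
      rfl
    · push Not at hj
      rw [Model.updTuple_of_notMem _ _ hj, smulVal, Model.updTuple_of_notMem _ _ hj]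
      rfl
  · rw [Model.updTuple_of_sort_ne _ _ _ ht, smulVal, Model.updTuple_of_sort_ne _ _ _ ht]
    rfl

/-- Permutations act by automorphisms, hence preserve satisfaction. -/
theorem sat_smulVal (g : colorGroup c) (φ : Formula) (v : (permModel c).Valuation) :
    Model.Sat (smulVal g v) φ ↔ Model.Sat v φ := by
  induction φ generalizing v with
  | falsum => rfl
  | eq s i j => exact smul_left_cancel_iff (α := colorGroup c) (β := PermDomain c s) g
  | app k hk p a => exact app_smul hk g _ _
  | imp φ ψ ihφ ihψ => rw [Model.sat_imp, Model.sat_imp, ihφ, ihψ]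
  | all s i φ ih =>
    rw [Model.sat_all, Model.sat_all]
    refine ⟨fun h d => ?_, fun h d => ?_⟩
    · rw [← ih, smulVal_upd]
      exact h _
    · have := (ih _).mpr (h (g⁻¹ • d : PermDomain c s))
      rwa [smulVal_upd, smul_inv_smul] at this

/-- The values of the free variables of a formula have a common finite support. -/
theorem exists_support (φ : Formula) (v : (permModel c).Valuation) :
    ∃ P : Finset I, ∀ g : colorGroup c, (∀ a ∈ P, g • a = a) →
      ∀ s i, Free s i φ → smulVal g v s i = v s i := by
  classical
  have hfin : {p : ℕ × ℕ | Free p.1 p.2 φ}.Finite := by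
    induction φ with
    | falsum => exact Set.finite_empty
    | eq t a b =>
      refine (Set.toFinite {(t, a), (t, b)}).subset ?_
      rintro ⟨s, i⟩ ⟨rfl, rfl | rfl⟩ <;> simp
    | app k hk p a =>
      refine ((Set.finite_singleton (k, p)).union
        (Set.finite_range fun t => ((0 : ℕ), a t))).subset ?_
      rintro ⟨s, i⟩ (⟨rfl, rfl⟩ | ⟨h, t, rfl⟩)
      · simp
      · exact .inr ⟨t, by simpa using h.symm⟩
    | imp φ ψ ihφ ihψ => exact ihφ.union ihψ
    | all t a φ ih => exact ih.subset fun p hp => hp.2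
  choose F hF using fun p : ℕ × ℕ => PermDomain.finitelySupported (v p.1 p.2 : PermDomain c p.1)
  exact ⟨hfin.toFinset.biUnion F, fun g hg s i hf => hF (s, i) g fun a ha => hg a (by
    simpa using ⟨s, i, hf, ha⟩)⟩

/-- Satisfaction of `H`, as a condition on a tuple `a` of atoms and a predicate `D`, is invariant
under the permutations that fix the values of the free variables of `H`. -/
theorem sat_smul_upd_updTuple {H : Formula} {v : (permModel c).Valuation} {g : colorGroup c}
    (hg : ∀ s i, Free s i H → smulVal g v s i = v s i) {n : ℕ} {x : Fin n → ℕ}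
    (hx : Function.Injective x) (a : Fin n → I) (m d : ℕ) (D : PermDomain c m) :
    Model.Sat (Model.upd (Model.updTuple v x (g • a)) m d (g • D)) H ↔
      Model.Sat (Model.upd (Model.updTuple v x a) m d D) H := by
  rw [← sat_smulVal g H (Model.upd (Model.updTuple v x a) m d D), smulVal_upd,
    smulVal_updTuple g v hx]
  exact Model.sat_congr fun s i hf =>
    Model.upd_congr _ _ _ (Model.updTuple_congr _ _ (hg s i hf).symm)

theorem sat_smul_updTuple {H : Formula} {v : (permModel c).Valuation} {g : colorGroup c}
    (hg : ∀ s i, Free s i H → smulVal g v s i = v s i) {n : ℕ} {x : Fin n → ℕ}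
    (hx : Function.Injective x) (a : Fin n → I) :
    Model.Sat (Model.updTuple v x (g • a)) H ↔ Model.Sat (Model.updTuple v x a) H := by
  rw [← sat_smulVal g H (Model.updTuple v x a), smulVal_updTuple g v hx]
  exact Model.sat_congr fun s i hf => Model.updTuple_congr _ _ (hg s i hf).symm

/-! ### The permutation model satisfies the Henkin axioms and the choice schema -/

theorem sat_comprehension {n : ℕ} (hn : 1 ≤ n) {p : ℕ} {x : Fin n → ℕ}
    (hx : Function.Injective x) {H : Formula} (hp : ¬ Free n p H) (v : (permModel c).Valuation) :
    Model.Sat v (comprehension n hn p x H) := by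
  obtain ⟨P, hP⟩ := exists_support H v
  let R : Set (Fin n → I) := {a | Model.Sat (Model.updTuple v x a) H}
  have hR : FinitelySupported c R := ⟨P, supports_set_of_forall fun g hg a ha =>
    (sat_smul_updTuple (hP g hg) hx a).mpr ha⟩
  rw [comprehension, Model.sat_ex]
  refine ⟨mkPred hn R hR, ?_⟩
  rw [Model.sat_allTuple _ hx]
  intro a
  rw [Model.sat_biimp, Model.sat_app, Model.updTuple_of_sort_ne _ _ _ (by omega), Model.upd_same,
    funext fun i => Model.updTuple_apply _ hx a i, app_mkPred]
  refine Model.sat_congr fun s i hf => Model.updTuple_congr _ _ (Model.upd_of_ne _ _ ?_).symm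
  rintro ⟨rfl, rfl⟩
  exact hp hf

theorem sat_extensionality {n : ℕ} (hn : 1 ≤ n) {p q : ℕ} (hpq : p ≠ q) {x : Fin n → ℕ}
    (hx : Function.Injective x) (v : (permModel c).Valuation) :
    Model.Sat v (extensionality n hn p q x) := by
  intro A B h
  rw [Model.sat_allTuple _ hx] at h
  have hA : Model.upd (Model.upd v n p A) n q B n p = A := by
    rw [Model.upd_of_ne _ _ fun h => hpq h.2, Model.upd_same]
  change Model.upd (Model.upd v n p A) n q B n p = Model.upd (Model.upd v n p A) n q B n q
  rw [hA, Model.upd_same]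
  refine permModel_ext hn fun a => ?_
  have := h a
  rwa [Model.sat_biimp, Model.sat_app, Model.sat_app, Model.updTuple_of_sort_ne _ _ _ (by omega),
    Model.updTuple_of_sort_ne _ _ _ (by omega), hA, Model.upd_same,
    funext fun i => Model.updTuple_apply _ hx a i] at this

theorem sat_choiceFormula [Finite C] {n m : ℕ} (hn : 1 ≤ n) (hm : 1 ≤ m) {x : Fin n → ℕ}
    {y : Fin m → ℕ} (hxy : Function.Injective (Fin.append x y)) (d : ℕ) {r : ℕ} {H : Formula}
    (hr : ¬ Free (n + m) r H) (v : (permModel c).Valuation) :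
    Model.Sat v (choiceFormula n m hm x y d r H) := by
  have hx : Function.Injective x := fun i j h =>
    Fin.castAdd_injective n m (hxy (by simpa using h))
  have hy : Function.Injective y := fun i j h =>
    Fin.natAdd_injective m n (hxy (by simpa using h))
  have hne : ∀ i j, y j ≠ x i := fun i j h => by
    have := congrArg Fin.val
      (hxy (a₁ := Fin.natAdd n j) (a₂ := Fin.castAdd m i) (by simpa using h))
    simp only [Fin.val_natAdd, Fin.val_castAdd] at this
    omega
  rw [choiceFormula, Model.sat_imp, Model.sat_allTuple _ hx, Model.sat_ex]
  intro h
  obtain ⟨P, hP⟩ := exists_support H v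
  obtain ⟨S, hS, hHS⟩ := exists_uniform_choice_tuple (c := c) (P := P)
    (H := fun (a : Fin n → I) (R : Set (Fin m → I)) => ∃ hR : FinitelySupported c R,
      Model.Sat (Model.upd (Model.updTuple v x a) m d (mkPred hm R hR)) H)
    (fun g hg a R ⟨hR, hsat⟩ => ⟨hR.smul g, by
      rw [← smul_mkPred hm R hR]
      exact (sat_smul_upd_updTuple (hP g hg) hx a m d _).mpr hsat⟩)
    (fun a => by
      obtain ⟨D, hD⟩ := (Model.sat_ex _ _ _ _).mp (h a)
      obtain ⟨R, hR, rfl⟩ := exists_eq_mkPred hm D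
      exact ⟨R, hR, hR, hD⟩)
  let T : Set (Fin (n + m) → I) :=
    (fun t => (fun i => t (Fin.castAdd m i), fun j => t (Fin.natAdd n j))) ⁻¹' S
  have hT : FinitelySupported c T := hS.preimage fun _ _ => rfl
  refine ⟨mkPred (hm.trans (Nat.le_add_left m n)) T hT, ?_⟩
  rw [Model.sat_allTuple _ hx]
  intro a
  obtain ⟨hR, hsat⟩ := hHS a
  rw [Model.sat_ex]
  refine ⟨mkPred hm _ hR, ?_⟩
  rw [Model.sat_conj]
  constructor
  · rw [Model.sat_allTuple _ hy]
    intro b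
    rw [Model.sat_biimp, Model.sat_app, Model.sat_app, Model.comp_append,
      funext fun i => Model.updTuple_apply _ hy b i,
      funext fun i => Model.updTuple_of_notMem _ b (hne i),
      Model.updTuple_of_sort_ne _ _ _ (by omega), Model.updTuple_of_sort_ne _ _ _ (by omega),
      Model.upd_same, Model.upd_of_sort_ne _ _ (by omega),
      Model.updTuple_of_sort_ne _ _ _ (by omega), Model.upd_same,
      funext fun i => Model.upd_of_sort_ne _ _ (by omega),
      funext fun i => Model.updTuple_apply _ hx a i, app_mkPred, app_mkPred]
    simp [T]
  · refine (Model.sat_congr fun s i hf => Model.upd_congr _ _ _ (Model.updTuple_congr _ _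
      (Model.upd_of_ne _ _ ?_))).mpr hsat
    rintro ⟨rfl, rfl⟩
    exact hr hf

/-- Soundness for the permutation model. -/
theorem sat_permModel_of_derivable [Finite C] {φ : Formula}
    (h : Derivable (henkinAxioms ∪ choiceSchema) φ) (v : (permModel c).Valuation) :
    Model.Sat v φ := by
  refine Model.sat_of_derivable (fun ψ hψ w => ?_) h v
  rcases hψ with (⟨n, hn, p, x, H, hx, hp, rfl⟩ | ⟨n, hn, p, q, x, hpq, hx, rfl⟩) |
    ⟨n, m, hn, hm, x, y, d, r, H, hxy, hr, rfl⟩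
  · exact sat_comprehension hn hx hp w
  · exact sat_extensionality hn hpq hx w
  · exact sat_choiceFormula hn hm hxy d hr w

/-- The domains are inhabited, so satisfaction under all valuations is not vacuous. -/
theorem permModel_valuation [Nonempty I] : Nonempty (permModel c).Valuation := by
  have : ∀ s, Nonempty (PermDomain c s) := fun s => by
    cases s with
    | zero => assumption
    | succ k => exact ⟨⟨∅, ∅, fun g _ => Set.smul_set_empty⟩⟩
  exact ⟨fun s _ => (this s).some⟩

end Permutations

/-! ### One atom: trichotomy and linear orderability hold -/

section OneAtom

instance : Subsingleton (PermDomain (id : Unit → Unit) 0) := inferInstanceAs (Subsingleton Unit)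

/-- The only permutation of one atom is the identity, so every relation is in the model. -/
theorem finitelySupported_of_unit {X : Type} [MulAction (colorGroup (id : Unit → Unit)) X] (x : X) :
    FinitelySupported (id : Unit → Unit) x :=
  ⟨∅, fun g _ => by rw [Subsingleton.elim g 1, one_smul]⟩

theorem exists_rel_of_unit {n : ℕ} (hn : 1 ≤ n)
    (r : (Fin n → Unit) → (Fin n → Unit) → Prop) :
    ∃ R : (permModel (id : Unit → Unit)).D (n + n), ∀ x y, Model.Rel R x y ↔ r x y := by
  refine ⟨mkPred (by omega) {t | r (fun _ => ()) fun _ => ()} (finitelySupported_of_unit _),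
    fun x y => ?_⟩
  rw [Model.Rel, app_mkPred]
  rfl

theorem sat_TR_of_unit {n : ℕ} (hn : 1 ≤ n) (v : (permModel (id : Unit → Unit)).Valuation) :
    Model.Sat v (TR n hn) := by
  rw [Model.sat_TR]
  intro A B
  obtain ⟨F, hF⟩ := exists_rel_of_unit hn fun x y =>
    (permModel (id : Unit → Unit)).app n A x ∧ (permModel (id : Unit → Unit)).app n B y
  by_cases hB : (permModel (id : Unit → Unit)).app n B fun _ => ()
  · exact ⟨F, .inl ⟨fun x y => (hF x y).mp, fun x hx => ⟨_, (hF x _).mpr ⟨hx, hB⟩⟩,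
      fun _ _ _ _ => Subsingleton.elim _ _, fun _ _ _ _ => Subsingleton.elim _ _⟩⟩
  · exact ⟨F, .inr ⟨fun x y h => (hB ((hF x y).mp h).2).elim, fun x hx => (hB hx).elim,
      fun _ _ _ _ => Subsingleton.elim _ _, fun _ _ _ _ => Subsingleton.elim _ _⟩⟩

theorem sat_LO_of_unit {n : ℕ} (hn : 1 ≤ n) (v : (permModel (id : Unit → Unit)).Valuation) :
    Model.Sat v (LO n hn) := by
  rw [Model.sat_LO]
  intro A
  obtain ⟨R, hR⟩ := exists_rel_of_unit hn fun x y =>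
    (permModel (id : Unit → Unit)).app n A x ∧ (permModel (id : Unit → Unit)).app n A y
  exact ⟨R, fun x y => (hR x y).mp, fun x y h => .inl ((hR x y).mpr h),
    fun _ _ _ => Subsingleton.elim _ _, fun x y z h =>
      (hR x z).mpr ⟨((hR x y).mp h.1).1, ((hR y z).mp h.2).2⟩⟩

end OneAtom

/-! ### Two infinite colours: trichotomy and linear orderability fail -/

section TwoColors

/-- The colouring of the atoms `Bool × ℕ` by their first component. -/
abbrev twoColors : Bool × ℕ → Bool := Prod.fst

/-- Outside a finite set there are two atoms of each colour, and they can be interchanged. -/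
theorem exists_swap (F : Finset (Bool × ℕ)) (k : Bool) :
    ∃ (a b : Bool × ℕ) (g : colorGroup twoColors), a ≠ b ∧ a.1 = k ∧ b.1 = k ∧
      (∀ e ∈ F, g • e = e) ∧ g • a = b ∧ g • b = a ∧ ∀ e : Bool × ℕ, e.1 ≠ k → g • e = e := by
  obtain ⟨i, hi⟩ := Infinite.exists_notMem_finset (F.image Prod.snd)
  obtain ⟨j, hj⟩ := Infinite.exists_notMem_finset (insert i (F.image Prod.snd))
  rw [Finset.mem_insert, not_or] at hj
  have hne : ∀ l, l ∉ F.image Prod.snd → ∀ e ∈ F, e ≠ (k, l) := by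
    rintro l hl e he rfl
    exact hl (Finset.mem_image_of_mem _ he)
  refine ⟨(k, i), (k, j), colorSwap (c := twoColors) (a := (k, i)) (b := (k, j)) rfl,
    fun h => hj.1 (congrArg Prod.snd h).symm, rfl, rfl, fun e he => colorSwap_smul_of_ne _ (hne i hi e he) (hne j hj.2 e he),
    colorSwap_smul_left _, colorSwap_smul_right _,
    fun e he => colorSwap_smul_of_ne _ ?_ ?_⟩ <;> rintro rfl <;> exact he rfl

theorem exists_rel_support {n : ℕ} (hn : 1 ≤ n) (R : (permModel twoColors).D (n + n)) :
    ∃ F : Finset (Bool × ℕ), ∀ g : colorGroup twoColors, (∀ e ∈ F, g • e = e) →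
      ∀ x y : Fin n → Bool × ℕ, Model.Rel R x y → Model.Rel R (g • x) (g • y) := by
  obtain ⟨F, hF⟩ := PermDomain.finitelySupported R
  refine ⟨F, fun g hg x y h => ?_⟩
  have happ : g • (Fin.append x y : Fin (n + n) → Bool × ℕ) = Fin.append (g • x) (g • y) := by
    funext i
    induction i using Fin.addCases <;>
      simp only [Pi.smul_apply, Fin.append_left, Fin.append_right]
  have := (app_smul (by omega) g R (Fin.append x y)).mpr h
  rw [hF g fun e he => hg e he] at this
  rwa [Model.Rel, ← happ]

/-- An interchange of two atoms outside the support of `R` is an automorphism of `R`, which a linear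
ordering does not allow. -/
theorem not_sat_LO {n : ℕ} (hn : 1 ≤ n) (v : (permModel twoColors).Valuation) :
    ¬ Model.Sat v (LO n hn) := by
  rw [Model.sat_LO]
  intro h
  obtain ⟨R, -, htotal, hantisymm, -⟩ :=
    h (mkPred hn Set.univ ⟨∅, fun _ _ => Set.smul_set_univ⟩)
  obtain ⟨F, hF⟩ := exists_rel_support hn R
  obtain ⟨a, b, g, hab, -, -, hg, hga, hgb, -⟩ := exists_swap F true
  have hga' : (g • fun _ => a : Fin n → Bool × ℕ) = fun _ => b := funext fun _ => hga
  have hgb' : (g • fun _ => b : Fin n → Bool × ℕ) = fun _ => a := funext fun _ => hgb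
  have h₁ : Model.Rel R (fun _ => a) (fun _ => b) → Model.Rel R (fun _ => b) (fun _ => a) :=
    fun h => by simpa only [hga', hgb'] using hF g hg _ _ h
  have h₂ : Model.Rel R (fun _ => b) (fun _ => a) → Model.Rel R (fun _ => a) (fun _ => b) :=
    fun h => by simpa only [hga', hgb'] using hF g hg _ _ h
  have heq : (fun _ : Fin n => a) = fun _ => b := by
    refine hantisymm _ _ ?_
    rcases htotal (fun _ => a) (fun _ => b) ⟨(app_mkPred _ _ _ _).mpr trivial,
      (app_mkPred _ _ _ _).mpr trivial⟩ with h | h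
    · exact ⟨h, h₁ h⟩
    · exact ⟨h₂ h, h⟩
  exact hab (congrFun heq ⟨0, hn⟩)

/-- The predicate "all entries of the tuple have the colour `k`". -/
def monochromatic {n : ℕ} (hn : 1 ≤ n) (k : Bool) : (permModel twoColors).D n :=
  mkPred hn {t | ∀ i, (t i).1 = k} ⟨∅, supports_set_of_forall fun g _ t ht i =>
    (g.2 (t i)).trans (ht i)⟩

/-- An interchange of two atoms of colour `k` outside the support of `F` fixes every tuple of the
other colour, so `F` takes the same value at two different constant tuples. -/
theorem not_isInjection_monochromatic {n : ℕ} (hn : 1 ≤ n) {k l : Bool} (hkl : l ≠ k)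
    (F : (permModel twoColors).D (n + n)) :
    ¬ Model.IsInjection F (monochromatic hn k) (monochromatic hn l) := by
  rintro ⟨hdom, htotal, -, hinj⟩
  obtain ⟨P, hP⟩ := exists_rel_support hn F
  obtain ⟨a, b, g, hab, hak, -, hg, hga, -, hfix⟩ := exists_swap P k
  obtain ⟨y, hy⟩ := htotal (fun _ => a) ((app_mkPred _ _ _ _).mpr fun _ => hak)
  have hyl : ∀ i, (y i).1 = l := (app_mkPred _ _ _ _).mp (hdom _ _ hy).2
  have hgy : g • y = y := funext fun i => hfix _ (by rw [hyl i]; exact hkl)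
  have hga' : (g • fun _ => a : Fin n → Bool × ℕ) = fun _ => b := funext fun _ => hga
  have hy' := hP g hg _ _ hy
  rw [hgy, hga'] at hy'
  exact hab (congrFun (hinj _ _ _ ⟨hy, hy'⟩) ⟨0, hn⟩)

theorem not_sat_TR {n : ℕ} (hn : 1 ≤ n) (v : (permModel twoColors).Valuation) :
    ¬ Model.Sat v (TR n hn) := by
  rw [Model.sat_TR]
  intro h
  obtain ⟨F, hF | hF⟩ := h (monochromatic hn true) (monochromatic hn false)
  · exact not_isInjection_monochromatic hn (by decide) F hF
  · exact not_isInjection_monochromatic hn (by decide) F hF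

end TwoColors

/-! ### Independence -/

theorem independent_of_sat {φ : Formula}
    (h₁ : ∀ v : (permModel (id : Unit → Unit)).Valuation, Model.Sat v φ)
    (h₂ : ∀ v : (permModel twoColors).Valuation, ¬ Model.Sat v φ) :
    Independent choiceSchema φ := by
  obtain ⟨v⟩ := permModel_valuation (c := (id : Unit → Unit))
  obtain ⟨w⟩ := permModel_valuation (c := twoColors)
  exact ⟨fun h => h₂ w (sat_permModel_of_derivable h w),
    fun h => sat_permModel_of_derivable h v (h₁ v)⟩

end HPL

theorem mainTheorem5 (n : ℕ) (hn : 1 ≤ n) :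
    HPL.Independent HPL.choiceSchema (HPL.TR n hn) ∧
      HPL.Independent HPL.choiceSchema (HPL.LO n hn) :=
  ⟨HPL.independent_of_sat (HPL.sat_TR_of_unit hn) (HPL.not_sat_TR hn),
    HPL.independent_of_sat (HPL.sat_LO_of_unit hn) (HPL.not_sat_LO hn)⟩
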